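/- Let $d\colon\mathbb{R}\to\mathbb{R}$ be an additive function, i.e. $d(x+y)=d(x)+d(y)$ for all $x,y\in\mathbb{R}$, and let $\xi\colon\mathbb{R}\to\mathbb{R}$ be one of the following functions: (a) $\xi(x)=a^{x}$, where $a>0$ and $a\neq 1$ is a fixed real number; (b) $\xi(x)=\cos(x)$; (c) $\xi(x)=\sin(x)$; (d) $\xi(x)=\cosh(x)$; (e) $\xi(x)=\sinh(x)$. Assume that the function $\varphi\colon\mathbb{R}\to\mathbb{R}$ defined by \[ \varphi(x)=d\left(\xi(x)\right)-\xi'(x)d(x)\qquad(x\in\mathbb{R}) \] is (locally) regular, that is, at least one of the following holds: (i) $\varphi$ is bounded on some Lebesgue measurable set of positive measure; (ii) $\varphi$ is continuous at some point; (iii) there is a Lebesgue measurable set of positive measure such that the restriction of $\varphi$ to this set is Lebesgue measurable. Then there exists a derivation $\chi\colon\mathbb{R}\to\mathbb{R}$, i.e. an additive function with $\chi(xy)=\chi(x)y+x\chi(y)$ for all $x,y\in\mathbb{R}$, such that \[ d(x)=\chi(x)+d(1)\cdot x\qquad(x\in\mathbb{R}). \] -/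

import Mathlib

open MeasureTheory

/-- A function `f : ℝ → ℝ` is *locally regular* if at least one of the following holds:
(i) `f` is bounded on a measurable set of positive measure;
(ii) `f` is continuous at a point;
(iii) the restriction of `f` to some set of positive Lebesgue measure is measurable in the sense
of Lebesgue.
Lebesgue measurability of sets is `NullMeasurableSet` with respect to `volume`. -/
def LocallyRegular (f : ℝ → ℝ) : Prop :=
  (∃ A : Set ℝ, NullMeasurableSet A volume ∧ 0 < volume A ∧ ∃ C : ℝ, ∀ x ∈ A, |f x| ≤ C) ∨
  (∃ x : ℝ, ContinuousAt f x) ∨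
  (∃ A : Set ℝ, NullMeasurableSet A volume ∧ 0 < volume A ∧
    ∀ B : Set ℝ, MeasurableSet B → NullMeasurableSet (A ∩ f ⁻¹' B) volume)

open Filter Topology Set
open scoped Pointwise

/-! Each `ξ` satisfies `ξ (x + y) + ξ (x - y) = 2 * c y * ξ x` with `c` a cosine or hyperbolic
cosine, and `deriv ξ` satisfies the same equation. Put `D_v u = d (v * u) - v * d u`. Combining `φ`
at `x + y`, `x - y` and `x` cancels `d x` and leaves `2 * D_{c y} (ξ x)` up to a term continuous in
`x`. For small `y`, the additive map `D_{c y}` is thus bounded on a set of positive measure, the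
image under `ξ` of a compact set, so it is linear. The `v` with `D_v` linear form a group containing
an interval of values of `c`, hence all of `ℝ`; this is the Leibniz rule for `d x - d 1 * x`. -/

/-- An additive function that is bounded on a measurable set of positive measure is linear. -/
theorem AddMonoidHom.eq_mul_of_bounded_on_pos_measure (g : ℝ →+ ℝ) {E : Set ℝ}
    (hE : MeasurableSet E) (hpos : 0 < volume E) {C : ℝ} (hC : ∀ x ∈ E, |g x| ≤ C) (x : ℝ) :
    g x = g 1 * x := by
  -- Steinhaus.
  have hD : E - E ∈ 𝓝 (0 : ℝ) := Measure.sub_mem_nhds_zero_of_addHaar_pos volume E hE hpos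
  have hb : ∀ z ∈ E - E, |g z| ≤ 2 * C := by
    rintro _ ⟨a, ha, b, hb, rfl⟩
    rw [map_sub]
    linarith [abs_sub (g a) (g b), hC a ha, hC b hb]
  have hc : Continuous g := g.continuous_of_isBounded_nhds_zero hD
    (isBounded_iff_forall_norm_le.2 ⟨2 * C, forall_mem_image.2 hb⟩)
  simpa [mul_comm] using map_real_smul g hc x 1

/-- For a compact set `K` of positive measure and small `y`, the set of `x` such that
`x`, `x + y` and `x - y` all lie in `K` contains a compact set of positive measure. -/
theorem eventually_exists_isCompact_add_sub_mem {K : Set ℝ} (hK : IsCompact K)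
    (hpos : 0 < volume K) :
    ∀ᶠ y in 𝓝 (0 : ℝ), ∃ L : Set ℝ, IsCompact L ∧ 0 < volume L ∧
      ∀ x ∈ L, x ∈ K ∧ x + y ∈ K ∧ x - y ∈ K := by
  have hev := eventually_nhds_zero_measure_vadd_sdiff_lt (μ := volume) hK hK.isClosed
    (ENNReal.half_pos hpos.ne').ne'
  have hev' := (continuous_neg.tendsto' (0 : ℝ) 0 neg_zero).eventually hev
  -- Translating by `-y` turns the part of `K` lost to one shift into the part gained by the
  -- opposite shift, which `hev` bounds.
  have key : ∀ y : ℝ, volume (K \ (y +ᵥ K)) = volume ((-y +ᵥ K) \ K) := by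
    intro y
    rw [← measure_vadd volume (-y) (K \ (y +ᵥ K)), vadd_set_sdiff, neg_vadd_vadd]
  filter_upwards [hev, hev'] with y hy hy'
  refine ⟨K ∩ ((y +ᵥ K) ∩ (-y +ᵥ K)),
    hK.inter ((hK.vadd y).inter (hK.vadd (-y))), ?_, ?_⟩
  · by_contra h0
    rw [not_lt, nonpos_iff_eq_zero] at h0
    have hsub : K ⊆ (K ∩ ((y +ᵥ K) ∩ (-y +ᵥ K))) ∪ ((K \ (y +ᵥ K)) ∪ (K \ (-y +ᵥ K))) := by
      intro x hx
      by_cases h1 : x ∈ y +ᵥ K <;> by_cases h2 : x ∈ -y +ᵥ K <;> simp [hx, h1, h2]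
    have : volume K < volume K := calc
      volume K ≤ 0 + (volume ((-y +ᵥ K) \ K) + volume ((y +ᵥ K) \ K)) := by
        refine (measure_mono hsub).trans ((measure_union_le _ _).trans ?_)
        rw [h0]
        gcongr
        refine (measure_union_le _ _).trans_eq ?_
        rw [key, key, neg_neg]
      _ < volume K / 2 + volume K / 2 := by
        rw [zero_add]
        exact ENNReal.add_lt_add hy' hy
      _ = volume K := ENNReal.add_halves _
    exact this.false
  · rintro x ⟨hx, ⟨a, ha, rfl⟩, b, hb, hba⟩
    simp only [vadd_eq_add] at *
    refine ⟨hx, ?_, ?_⟩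
    · convert hb using 1; linarith
    · convert ha using 1; ring

/-- A `C¹` function whose derivative has countably many zeros maps measurable sets of positive
measure to sets of positive measure. -/
theorem volume_image_pos_of_countable_deriv_eq_zero {f : ℝ → ℝ} (hf : ContDiff ℝ 1 f)
    (hz : {x | deriv f x = 0}.Countable) {s : Set ℝ} (hs : MeasurableSet s)
    (hpos : 0 < volume s) : 0 < volume (f '' s) := by
  set Z := {x | deriv f x = 0}
  have hsZ : volume (s \ Z) ≠ 0 := by
    rw [measure_sdiff_null (hz.measure_zero volume)]
    exact hpos.ne'
  -- Near `b` the set keeps positive measure and `f` is injective, so the area formula applies.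
  obtain ⟨b, hb, hnhds⟩ := exists_mem_forall_mem_nhdsWithin_pos_measure hsZ
  have hstrict : HasStrictDerivAt f (deriv f b) b :=
    hf.contDiffAt.hasStrictDerivAt one_ne_zero
  obtain ⟨U, hU, hUo, hbU⟩ := _root_.eventually_nhds_iff.1 (hstrict.eventually_left_inverse hb.2)
  set t := (s \ Z) ∩ U
  have ht : MeasurableSet t := (hs.diff hz.measurableSet).inter hUo.measurableSet
  have htpos : 0 < volume t :=
    hnhds t (inter_mem self_mem_nhdsWithin (mem_nhdsWithin_of_mem_nhds (hUo.mem_nhds hbU)))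
  have hinj : InjOn f t := fun x hx y hy hxy => by
    rw [← hU x hx.2, ← hU y hy.2, hxy]
  have harea := lintegral_image_eq_lintegral_abs_deriv_mul ht
    (fun x _ => ((hf.differentiable one_ne_zero) x).hasDerivAt.hasDerivWithinAt) hinj
    (fun _ => 1)
  simp only [lintegral_const, MeasurableSet.univ, Measure.restrict_apply, univ_inter, one_mul,
    mul_one] at harea
  refine lt_of_lt_of_le ?_ (measure_mono (image_mono (fun x hx => hx.1.1 : t ⊆ s)))
  rw [harea, setLIntegral_pos_iff (by fun_prop)]
  refine htpos.trans_le (measure_mono fun x hx => ⟨?_, hx⟩)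
  exact (ENNReal.ofReal_pos.2 (abs_pos.2 hx.1.2)).ne'

/-- A locally regular function is bounded on a compact set of positive measure. -/
theorem LocallyRegular.exists_isCompact_bounded {f : ℝ → ℝ} (hf : LocallyRegular f) :
    ∃ K : Set ℝ, IsCompact K ∧ 0 < volume K ∧ ∃ C : ℝ, ∀ x ∈ K, |f x| ≤ C := by
  have hnull : ∀ A : Set ℝ, NullMeasurableSet A volume → 0 < volume A →
      (∃ C : ℝ, ∀ x ∈ A, |f x| ≤ C) →
      ∃ K : Set ℝ, IsCompact K ∧ 0 < volume K ∧ ∃ C : ℝ, ∀ x ∈ K, |f x| ≤ C := by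
    rintro A hA hpos ⟨C, hC⟩
    obtain ⟨t, htA, ht, hte⟩ := hA.exists_measurable_subset_ae_eq
    obtain ⟨K, hKt, hK, hKpos⟩ := ht.exists_lt_isCompact (hpos.trans_eq (measure_congr hte).symm)
    exact ⟨K, hK, hKpos, C, fun x hx => hC x (htA (hKt hx))⟩
  rcases hf with ⟨A, hA, hpos, hC⟩ | ⟨x, hx⟩ | ⟨A, hA, hpos, hB⟩
  · exact hnull A hA hpos hC
  · obtain ⟨U, hU, hUo, hxU⟩ :=
      _root_.eventually_nhds_iff.1 (hx.abs.eventually (gt_mem_nhds (lt_add_one |f x|)))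
    exact hnull U hUo.measurableSet.nullMeasurableSet (hUo.measure_pos volume ⟨x, hxU⟩)
      ⟨|f x| + 1, fun y hy => (hU y hy).le⟩
  · have hcover : A = ⋃ n : ℕ, A ∩ f ⁻¹' Icc (-(n : ℝ)) n := by
      ext x
      simp only [mem_iUnion, mem_inter_iff, mem_preimage, mem_Icc, ← abs_le]
      exact ⟨fun h => (exists_nat_ge |f x|).imp fun n hn => ⟨h, hn⟩, fun ⟨_, h⟩ => h.1⟩
    rw [hcover] at hpos
    obtain ⟨n, hn⟩ := exists_measure_pos_of_not_measure_iUnion_null hpos.ne'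
    exact hnull _ (hB _ measurableSet_Icc) hn ⟨n, fun x hx => abs_le.2 hx.2⟩

/-- An additive subgroup of `ℝ` containing a nondegenerate closed interval is everything. -/
theorem AddSubgroup.eq_top_of_Icc_subset (T : AddSubgroup ℝ) {p q : ℝ} (hpq : p < q)
    (h : Icc p q ⊆ (T : Set ℝ)) : T = ⊤ := by
  refine T.eq_top_iff'.2 fun v => ?_
  obtain ⟨n, hn⟩ := exists_nat_gt (|v| / (q - p))
  have hqp := sub_pos.2 hpq
  have hn0 : (0 : ℝ) < n := (by positivity : 0 ≤ |v| / (q - p)).trans_lt hn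
  -- So `|v| / n` is a difference of two points of the interval.
  have hsmall : |v| / n ≤ q - p := by
    rw [div_lt_iff₀ hqp] at hn
    rw [div_le_iff₀ hn0]
    linarith
  have habs : |v| / n ∈ T := by
    have := T.sub_mem (h ⟨by linarith [show 0 ≤ |v| / n by positivity], by linarith⟩ :
      p + |v| / n ∈ T) (h ⟨le_rfl, hpq.le⟩)
    simpa using this
  have hv : |v| ∈ T := by
    have := T.nsmul_mem habs n
    rwa [nsmul_eq_mul, mul_div_cancel₀ _ hn0.ne'] at this
  rcases abs_choice v with h | h
  · rwa [h] at hv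
  · rw [h] at hv
    simpa using hv

/-- The defect `u ↦ d (v * u) - v * d u` of `d` with respect to multiplication by `v`. -/
noncomputable def AddMonoidHom.mulDefect (d : ℝ →+ ℝ) (v : ℝ) : ℝ →+ ℝ :=
  d.comp (AddMonoidHom.mulLeft v) - (AddMonoidHom.mulLeft v).comp d

theorem AddMonoidHom.mulDefect_apply (d : ℝ →+ ℝ) (v u : ℝ) :
    d.mulDefect v u = d (v * u) - v * d u := rfl

/-- The multipliers `v` for which the defect of `d` is linear. -/
def AddMonoidHom.linearDefects (d : ℝ →+ ℝ) : AddSubgroup ℝ where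
  carrier := {v | ∀ u, d.mulDefect v u = d.mulDefect v 1 * u}
  zero_mem' u := by simp [mulDefect_apply]
  add_mem' {v w} hv hw u := by
    have h1 := hv u
    have h2 := hw u
    simp only [mulDefect_apply, add_mul, map_add] at *
    linarith
  neg_mem' {v} hv u := by
    have h1 := hv u
    simp only [mulDefect_apply, neg_mul, map_neg] at *
    linarith

/-- If all multiplicative defects of `d` are linear, then `d` is a derivation plus a linear map. -/
theorem AddMonoidHom.exists_derivation_of_linearDefects_eq_top (d : ℝ →+ ℝ)
    (h : d.linearDefects = ⊤) : ∃ χ : Derivation ℤ ℝ ℝ, ∀ x : ℝ, d x = χ x + d 1 * x := by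
  -- Linearity of the defect, with its slope at `u = 1` written out.
  have hd : ∀ v u, d (v * u) - v * d u = (d v - v * d 1) * u := by
    intro v u
    have : v ∈ d.linearDefects := h ▸ AddSubgroup.mem_top v
    simpa [mulDefect_apply] using this u
  refine ⟨Derivation.mk' (d - AddMonoidHom.mulLeft (d 1)).toIntLinearMap fun x y => ?_,
    fun x => ?_⟩
  · have := hd x y
    simp only [AddMonoidHom.coe_toIntLinearMap, AddMonoidHom.sub_apply,
      AddMonoidHom.coe_mulLeft, smul_eq_mul]
    linarith
  · simp

/-- If `ξ (x + y) + ξ (x - y) = 2 * c y * ξ x` with a continuous `c` that is not constant near `0`,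
and `d (ξ x) - deriv ξ x * d x` is locally regular, then the additive function `d` is a derivation
plus a linear map. -/
theorem exists_derivation_of_cosine_equation (d : ℝ →+ ℝ) {ξ c : ℝ → ℝ} (hξ : ContDiff ℝ 1 ξ)
    (hz : {x | deriv ξ x = 0}.Countable) (hc : Continuous c)
    (hc' : ∀ ε > 0, ∃ y, |y| < ε ∧ c y ≠ c 0)
    (hadd : ∀ x y, ξ (x + y) + ξ (x - y) = 2 * c y * ξ x)
    (hreg : LocallyRegular (fun x : ℝ => d (ξ x) - deriv ξ x * d x)) :
    ∃ χ : Derivation ℤ ℝ ℝ, ∀ x : ℝ, d x = χ x + d 1 * x := by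
  apply d.exists_derivation_of_linearDefects_eq_top
  have hdiff : Differentiable ℝ ξ := hξ.differentiable one_ne_zero
  have hcd : Continuous (deriv ξ) := hξ.continuous_deriv le_rfl
  have hadd' : ∀ x y, deriv ξ (x + y) + deriv ξ (x - y) = 2 * c y * deriv ξ x := by
    intro x y
    have h1 := ((hdiff (x + y)).hasDerivAt.comp_add_const x y).add
      ((hdiff (x - y)).hasDerivAt.comp_sub_const x y)
    have h2 := (hdiff x).hasDerivAt.const_mul (2 * c y)
    refine h1.unique (h2.congr_of_eventuallyEq (Eventually.of_forall fun z => ?_))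
    exact hadd z y
  obtain ⟨K, hK, hKpos, C, hC⟩ := hreg.exists_isCompact_bounded
  have hmem : ∀ᶠ y in 𝓝 (0 : ℝ), c y ∈ d.linearDefects := by
    filter_upwards [eventually_exists_isCompact_add_sub_mem hK hKpos] with y hy
    obtain ⟨L, hL, hLpos, hLK⟩ := hy
    obtain ⟨M, hM⟩ := hL.exists_bound_of_continuousOn (f := fun x =>
      (deriv ξ (x + y) - deriv ξ (x - y)) * d y) (by fun_prop)
    refine (d.mulDefect (c y)).eq_mul_of_bounded_on_pos_measure
      (hL.image hξ.continuous).measurableSet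
      (volume_image_pos_of_countable_deriv_eq_zero hξ hz hL.measurableSet hLpos)
      (C := (C + C + 2 * |c y| * C + M) / 2) ?_
    rintro _ ⟨x, hx, rfl⟩
    obtain ⟨h0, h1, h2⟩ := hLK x hx
    have b0 := hC _ h0
    have b1 := hC _ h1
    have b2 := hC _ h2
    have b3 := hM x hx
    rw [Real.norm_eq_abs] at b3
    -- The `d x` terms vanish by the cosine equation for `deriv ξ`.
    have hid : 2 * d.mulDefect (c y) (ξ x) =
        (d (ξ (x + y)) - deriv ξ (x + y) * d (x + y)) +
        (d (ξ (x - y)) - deriv ξ (x - y) * d (x - y)) -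
        2 * c y * (d (ξ x) - deriv ξ x * d x) +
        (deriv ξ (x + y) - deriv ξ (x - y)) * d y := by
      have e1 : d (ξ (x + y)) + d (ξ (x - y)) = 2 * d (c y * ξ x) := by
        rw [← map_add, hadd, mul_assoc, two_mul, map_add, two_mul]
      rw [AddMonoidHom.mulDefect_apply, map_add d x y, map_sub d x y]
      linear_combination -e1 + d x * hadd' x y
    have b4 : |2 * c y * (d (ξ x) - deriv ξ x * d x)| ≤ 2 * |c y| * C := by
      rw [abs_mul, abs_mul, abs_two]
      gcongr
    have b5 : |2 * d.mulDefect (c y) (ξ x)| ≤ C + C + 2 * |c y| * C + M := by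
      rw [hid]
      refine (abs_add_le _ _).trans (add_le_add ((abs_sub _ _).trans
        (add_le_add ((abs_add_le _ _).trans (add_le_add b1 b2)) b4)) b3)
    rw [abs_mul, abs_two] at b5
    linarith
  obtain ⟨ε, hε, hball⟩ := Metric.eventually_nhds_iff_ball.1 hmem
  obtain ⟨y, hy, hne⟩ := hc' ε hε
  have hsub : uIcc (c 0) (c y) ⊆ (d.linearDefects : Set ℝ) := by
    refine (intermediate_value_uIcc hc.continuousOn).trans ?_
    rintro _ ⟨z, hz, rfl⟩
    refine hball z ?_
    rw [mem_ball_zero_iff, Real.norm_eq_abs]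
    have := abs_sub_left_of_mem_uIcc hz
    simp only [sub_zero] at this
    exact this.trans_lt hy
  exact d.linearDefects.eq_top_of_Icc_subset (min_lt_max.2 hne.symm) hsub

theorem mainTheorem10 (d : ℝ →+ ℝ) (ξ : ℝ → ℝ)
    (hξ : (∃ a : ℝ, 0 < a ∧ a ≠ 1 ∧ ξ = fun x : ℝ => a ^ x) ∨
      ξ = Real.cos ∨ ξ = Real.sin ∨ ξ = Real.cosh ∨ ξ = Real.sinh)
    (hreg : LocallyRegular (fun x : ℝ => d (ξ x) - deriv ξ x * d x)) :
    ∃ χ : Derivation ℤ ℝ ℝ, ∀ x : ℝ, d x = χ x + d 1 * x := by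
  have hcos : ∀ ε > 0, ∃ y : ℝ, |y| < ε ∧ Real.cos y ≠ Real.cos 0 := by
    intro ε hε
    have hpos : 0 < min (ε / 2) 1 := lt_min (half_pos hε) one_pos
    refine ⟨min (ε / 2) 1, ?_, ?_⟩
    · rw [abs_of_pos hpos]
      exact (min_le_left _ _).trans_lt (half_lt_self hε)
    · exact (Real.cos_lt_cos_of_nonneg_of_le_pi le_rfl
        ((min_le_right _ _).trans (by linarith [Real.pi_gt_three])) hpos).ne
  have hcosh : ∀ k : ℝ, k ≠ 0 → ∀ ε > 0, ∃ y : ℝ, |y| < ε ∧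
      Real.cosh (k * y) ≠ Real.cosh (k * 0) := by
    intro k hk ε hε
    refine ⟨ε / 2, ?_, ?_⟩
    · rw [abs_of_pos (half_pos hε)]
      exact half_lt_self hε
    · rw [mul_zero, Real.cosh_zero]
      exact (Real.one_lt_cosh.2 (mul_ne_zero hk (half_pos hε).ne')).ne'
  have hcosh' : ∀ ε > 0, ∃ y : ℝ, |y| < ε ∧ Real.cosh y ≠ Real.cosh 0 := by
    simpa using hcosh 1 one_ne_zero
  rcases hξ with ⟨a, ha, ha1, rfl⟩ | rfl | rfl | rfl | rfl
  · have hlog : Real.log a ≠ 0 := Real.log_ne_zero_of_pos_of_ne_one ha ha1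
    have heq : (fun x : ℝ => a ^ x) = fun x => Real.exp (Real.log a * x) :=
      funext fun x => Real.rpow_def_of_pos ha x
    -- The even part of `a ^ y` serves as `c`.
    refine exists_derivation_of_cosine_equation d (c := fun y => Real.cosh (Real.log a * y))
      ?_ ?_ (by fun_prop) (hcosh _ hlog) (fun x y => ?_) hreg
    · rw [heq]
      fun_prop
    · convert countable_empty (α := ℝ)
      refine eq_empty_of_forall_notMem fun x hx => ?_
      rw [mem_ofPred_eq, (Real.hasStrictDerivAt_const_rpow ha x).hasDerivAt.deriv] at hx
      exact mul_ne_zero (Real.rpow_pos_of_pos ha x).ne' hlog hx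
    · simp only [Real.rpow_def_of_pos ha, Real.cosh_eq, mul_add, mul_sub, Real.exp_add,
        Real.exp_sub, Real.exp_neg]
      ring
  · refine exists_derivation_of_cosine_equation d Real.contDiff_cos ?_ Real.continuous_cos hcos
      (fun x y => ?_) hreg
    · refine (countable_range fun n : ℤ => (n : ℝ) * Real.pi).mono fun x hx => ?_
      rw [mem_ofPred_eq, Real.deriv_cos, neg_eq_zero] at hx
      exact Real.sin_eq_zero_iff.1 hx
    · rw [Real.cos_add, Real.cos_sub]
      ring
  · refine exists_derivation_of_cosine_equation d Real.contDiff_sin ?_ Real.continuous_cos hcos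
      (fun x y => ?_) hreg
    · refine (countable_range fun n : ℤ => (2 * (n : ℝ) + 1) * Real.pi / 2).mono fun x hx => ?_
      rw [mem_ofPred_eq, Real.deriv_sin] at hx
      exact (Real.cos_eq_zero_iff.1 hx).imp fun _ h => h.symm
    · rw [Real.sin_add, Real.sin_sub]
      ring
  · refine exists_derivation_of_cosine_equation d Real.contDiff_cosh ?_ Real.continuous_cosh hcosh'
      (fun x y => ?_) hreg
    · refine (countable_singleton (0 : ℝ)).mono fun x hx => ?_
      rw [mem_ofPred_eq, Real.deriv_cosh] at hx
      exact Real.sinh_eq_zero.1 hx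
    · rw [Real.cosh_add, Real.cosh_sub]
      ring
  · refine exists_derivation_of_cosine_equation d Real.contDiff_sinh ?_ Real.continuous_cosh hcosh'
      (fun x y => ?_) hreg
    · convert countable_empty (α := ℝ)
      refine eq_empty_of_forall_notMem fun x hx => ?_
      rw [mem_ofPred_eq, Real.deriv_sinh] at hx
      exact (Real.cosh_pos x).ne' hx
    · rw [Real.sinh_add, Real.sinh_sub]
      ring
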